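/- **Lemma 1.** For a real matrix $X\in\mathbb R^{m\times n}$ let $\|X\|_2$ be its spectral norm, $\|X\|_F$ its Frobenius norm, and $\langle X,Y\rangle=\operatorname{tr}(X^TY)$. Let $q:=\min(m,n)$. For $X$ with compact singular value decomposition $X=U\operatorname{diag}(\sigma_1,\dots,\sigma_q)V^T$, define the spectral clipping $\operatorname{clip}^{\mathrm{sp}}_c(X):=U\operatorname{diag}(\operatorname{clip}_c(\sigma_1),\dots,\operatorname{clip}_c(\sigma_q))V^T$, where $\operatorname{clip}_c(x)=\operatorname{sign}(x)\min(|x|,c)$. A random matrix $U\in\mathbb R^{d\times r}$ with $\mathbb E[U]=0$ and $U^TU=I_r$ is said to have *bounded anisotropy* with parameter $\kappa>0$ if $\mathbb E[UU^T]\preceq\frac{\kappa r}{d}I_d$. Let $r\ge 1$ and let $G\in\mathbb R^{m\times n}$ be a fixed matrix. Let $g=G+N$ with $N=\ell\,U_NV_N^T$, $\ell>0$, where $U_N\in\mathbb R^{m\times r}$ and $V_N\in\mathbb R^{n\times r}$ are independent zero-mean random matrices with orthonormal columns, both of bounded anisotropy with the same parameter $\kappa\le\frac{q}{25r^2}$.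 Let $\tilde g=\operatorname{clip}^{\mathrm{sp}}_c(g)$, and suppose that $\ell\ge 9\sqrt r\,\|G\|_2$. Then for every $c\ge\|G\|_2$ the random variables $\langle G,\tilde g\rangle$ and $\|\tilde g\|_F^2$ are integrable, and $$\mathbb E[\langle G,\tilde g\rangle]\ \ge\ \tfrac13\|G\|_F^2,\qquad \mathbb E[\|\tilde g\|_F^2]\ \le\ r\,\min(c,\ \ell+\|G\|_2)^2+\|G\|_F^2 .$$ -/

import Mathlib

open MeasureTheory ProbabilityTheory

/-- The Frobenius norm `‖A‖_F` of a real matrix. -/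
noncomputable def frobNorm {m n : ℕ} (A : Matrix (Fin m) (Fin n) ℝ) : ℝ :=
  Matrix.frobeniusNormedAddCommGroup.toNorm.norm A

/-- The spectral norm `‖A‖₂`: the operator norm of `A` between Euclidean spaces. -/
noncomputable def specNorm {m n : ℕ} (A : Matrix (Fin m) (Fin n) ℝ) : ℝ :=
  Matrix.instL2OpNormedAddCommGroup.toNorm.norm A

/-- The trace (Frobenius) inner product `⟨A, B⟩ = tr (Aᵀ B)`. -/
def frobInner {m n : ℕ} (A B : Matrix (Fin m) (Fin n) ℝ) : ℝ :=
  (A.transpose * B).trace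

/-- `X = U diag(s) Vᵀ` is a compact singular value decomposition of `X`: with `q = min m n`, the
matrices `U` (of size `m × q`) and `V` (of size `n × q`) have orthonormal columns, and the
`q` singular values `s` are nonnegative. -/
structure IsCompactSVD {m n : ℕ} (X : Matrix (Fin m) (Fin n) ℝ)
    (U : Matrix (Fin m) (Fin (min m n)) ℝ) (s : Fin (min m n) → ℝ)
    (V : Matrix (Fin n) (Fin (min m n)) ℝ) : Prop where
  left_orthonormal : U.transpose * U = 1
  right_orthonormal : V.transpose * V = 1
  nonneg : ∀ i, 0 ≤ s i
  eq : X = U * Matrix.diagonal s * V.transpose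

theorem exists_svd_of_le {m n : ℕ} (h : n ≤ m) (X : Matrix (Fin m) (Fin n) ℝ) :
    ∃ (U : Matrix (Fin m) (Fin n) ℝ) (s : Fin n → ℝ) (V : Matrix (Fin n) (Fin n) ℝ),
      U.transpose * U = 1 ∧ V.transpose * V = 1 ∧ (∀ i, 0 ≤ s i) ∧
        X = U * Matrix.diagonal s * V.transpose := by
  classical
  have hA : (X.transpose * X).PosSemidef := by
    simpa using Matrix.posSemidef_conjTranspose_mul_self X
  set b := hA.isHermitian.eigenvectorBasis with hb
  set l := hA.isHermitian.eigenvalues with hl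
  have hl0 : ∀ i, 0 ≤ l i := fun i => hA.eigenvalues_nonneg i
  have horth : ∀ i j, (b i).ofLp ⬝ᵥ (b j).ofLp = if i = j then 1 else 0 := by
    intro i j
    have := orthonormal_iff_ite.1 b.orthonormal j i
    rw [EuclideanSpace.inner_eq_star_dotProduct] at this
    simpa [eq_comm] using this
  have hw : ∀ i j, X.mulVec (b i).ofLp ⬝ᵥ X.mulVec (b j).ofLp = if i = j then l i else 0 := by
    intro i j
    have h1 : X.mulVec (b i).ofLp ⬝ᵥ X.mulVec (b j).ofLp
        = (b i).ofLp ⬝ᵥ (X.transpose * X).mulVec (b j).ofLp := by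
      rw [← Matrix.mulVec_mulVec, Matrix.dotProduct_mulVec _ X.transpose, Matrix.vecMul_transpose]
    rw [h1, hA.isHermitian.mulVec_eigenvectorBasis j, dotProduct_smul, horth]
    by_cases hij : i = j
    · subst hij; simp [hl]
    · simp [hij]
  let v : Fin m → EuclideanSpace ℝ (Fin m) := fun k =>
    if hk : (k : ℕ) < n then
      WithLp.toLp 2 ((Real.sqrt (l ⟨k, hk⟩))⁻¹ • X.mulVec (b ⟨k, hk⟩).ofLp) else 0
  let S : Set (Fin m) := {k | ∃ hk : (k : ℕ) < n, l ⟨k, hk⟩ ≠ 0}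
  have hv : Orthonormal ℝ (S.domRestrict v) := by
    rw [orthonormal_iff_ite]
    rintro ⟨k, hk, hlk⟩ ⟨k', hk', hlk'⟩
    simp only [Set.domRestrict_apply, v, hk, hk', dif_pos]
    rw [EuclideanSpace.inner_eq_star_dotProduct]
    simp only [star_trivial, smul_dotProduct, dotProduct_smul, hw, smul_eq_mul, Subtype.mk.injEq,
      Fin.mk.injEq]
    by_cases hkk : k = k'
    · subst hkk
      have h0 : Real.sqrt (l ⟨k, hk⟩) ≠ 0 :=
        (Real.sqrt_pos.2 (lt_of_le_of_ne (hl0 _) (Ne.symm hlk))).ne'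
      have h2 := Real.mul_self_sqrt (hl0 ⟨k, hk⟩)
      simp only [if_true]
      field_simp
      nlinarith
    · have : (k' : ℕ) ≠ k := fun hc => hkk (Fin.ext hc.symm)
      simp [this, hkk]
  obtain ⟨u, hu⟩ := hv.exists_orthonormalBasis_extension_of_card_eq (by simp)
  have horthu : ∀ i j, (u i).ofLp ⬝ᵥ (u j).ofLp = if i = j then 1 else 0 := by
    intro i j
    have := orthonormal_iff_ite.1 u.orthonormal j i
    rw [EuclideanSpace.inner_eq_star_dotProduct] at this
    simpa [eq_comm] using this
  let U : Matrix (Fin m) (Fin n) ℝ := Matrix.of fun a i => (u (Fin.castLE h i)).ofLp a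
  let V : Matrix (Fin n) (Fin n) ℝ := Matrix.of fun a i => (b i).ofLp a
  have hVV : V.transpose * V = 1 := by
    ext i j
    rw [Matrix.mul_apply, Matrix.one_apply, ← horth i j]
    rfl
  have hXV : X * V = U * Matrix.diagonal fun i => Real.sqrt (l i) := by
    ext a i
    rw [Matrix.mul_diagonal]
    have h1 : (X * V) a i = X.mulVec (b i).ofLp a := rfl
    rw [h1]
    by_cases hli : l i = 0
    · have h2 := hw i i
      rw [if_pos rfl, hli, dotProduct_self_eq_zero] at h2
      rw [h2, hli]; simp
    · have h2 := hu (Fin.castLE h i) ⟨i.2, hli⟩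
      have h0 : Real.sqrt (l i) ≠ 0 :=
        (Real.sqrt_pos.2 (lt_of_le_of_ne (hl0 _) (Ne.symm hli))).ne'
      simp only [U, Matrix.of_apply, h2, v]
      simp [mul_comm, h0]
  refine ⟨U, fun i => Real.sqrt (l i), V, ?_, hVV, fun i => Real.sqrt_nonneg _, ?_⟩
  · ext i j
    have h3 := horthu (Fin.castLE h i) (Fin.castLE h j)
    rw [Matrix.mul_apply, Matrix.one_apply]
    simp only [(Fin.castLE_injective h).eq_iff] at h3
    rw [← h3]
    rfl
  · rw [← hXV, Matrix.mul_assoc, mul_eq_one_comm.1 hVV, Matrix.mul_one]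

theorem exists_isCompactSVD {m n : ℕ} (X : Matrix (Fin m) (Fin n) ℝ) :
    ∃ U s V, IsCompactSVD X U s V := by
  suffices H : ∃ (U : Matrix (Fin m) (Fin (min m n)) ℝ) (s : Fin (min m n) → ℝ)
      (V : Matrix (Fin n) (Fin (min m n)) ℝ), U.transpose * U = 1 ∧ V.transpose * V = 1 ∧
        (∀ i, 0 ≤ s i) ∧ X = U * Matrix.diagonal s * V.transpose by
    obtain ⟨U, s, V, h1, h2, h3, h4⟩ := H
    exact ⟨U, s, V, h1, h2, h3, h4⟩
  rcases le_total n m with h | h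
  · obtain ⟨q, hq⟩ : ∃ q, q = min m n := ⟨_, rfl⟩
    rw [← hq]
    obtain rfl : q = n := hq.trans (min_eq_right h)
    exact exists_svd_of_le h X
  · obtain ⟨q, hq⟩ : ∃ q, q = min m n := ⟨_, rfl⟩
    rw [← hq]
    obtain rfl : q = m := hq.trans (min_eq_left h)
    obtain ⟨U, s, V, h1, h2, h3, h4⟩ := exists_svd_of_le h X.transpose
    refine ⟨V, s, U, h2, h1, h3, ?_⟩
    rw [← X.transpose_transpose, h4]
    simp [Matrix.transpose_mul, Matrix.mul_assoc]

/-- Scalar clipping `clip_c(x) = sign(x) min(|x|, c)`. -/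
noncomputable def scalarClip (c x : ℝ) : ℝ := SignType.sign x * min |x| c

/-- Spectral clipping: `U diag(clip_c(s₁), …, clip_c(s_q)) Vᵀ` for a compact singular value
decomposition `X = U diag(s) Vᵀ`. -/
noncomputable def spectralClip {m n : ℕ} (c : ℝ) (X : Matrix (Fin m) (Fin n) ℝ) :
    Matrix (Fin m) (Fin n) ℝ :=
  (exists_isCompactSVD X).choose *
    Matrix.diagonal (fun i => scalarClip c ((exists_isCompactSVD X).choose_spec.choose i)) *
    (exists_isCompactSVD X).choose_spec.choose_spec.choose.transpose

/-- Spectral clipping does not depend on the chosen singular value decomposition. -/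
theorem spectralClip_eq {m n : ℕ} (c : ℝ) {X : Matrix (Fin m) (Fin n) ℝ}
    {U : Matrix (Fin m) (Fin (min m n)) ℝ} {s : Fin (min m n) → ℝ}
    {V : Matrix (Fin n) (Fin (min m n)) ℝ} (hX : IsCompactSVD X U s V) :
    spectralClip c X = U * Matrix.diagonal (fun i => scalarClip c (s i)) * V.transpose := by
  suffices H : ∀ {U' : Matrix (Fin m) (Fin (min m n)) ℝ} {s' : Fin (min m n) → ℝ}
      {V' : Matrix (Fin n) (Fin (min m n)) ℝ}, IsCompactSVD X U' s' V' →
      U' * Matrix.diagonal (fun i => scalarClip c (s' i)) * V'.transpose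
        = U * Matrix.diagonal (fun i => scalarClip c (s i)) * V.transpose from
    H (exists_isCompactSVD X).choose_spec.choose_spec.choose_spec
  intro U' s' V' hX'
  let g : ℝ → ℝ := fun x => scalarClip c x / x
  have hg : ∀ x, scalarClip c x = x * g x := by
    intro x
    by_cases hx : x = 0
    · simp [hx, scalarClip]
    · simp only [g]; field_simp
  have hd : ∀ t : Fin (min m n) → ℝ, Matrix.diagonal (fun i => scalarClip c (t i))
      = Matrix.diagonal t * Matrix.diagonal (fun i => g (t i)) := by
    intro t
    rw [Matrix.diagonal_mul_diagonal]
    simp only [hg]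
  have hd' : ∀ t : Fin (min m n) → ℝ, Matrix.diagonal t * Matrix.diagonal (fun i => g (t i))
      = Matrix.diagonal (fun i => g (t i)) * Matrix.diagonal t := by
    intro t
    simp only [Matrix.diagonal_mul_diagonal, mul_comm]
  have key : ∀ {W : Matrix (Fin m) (Fin (min m n)) ℝ} {t : Fin (min m n) → ℝ}
      {Z : Matrix (Fin n) (Fin (min m n)) ℝ}, IsCompactSVD X W t Z →
      X * Z = W * Matrix.diagonal t ∧ X.transpose * W = Z * Matrix.diagonal t := by
    intro W t Z hW
    constructor
    · rw [hW.eq, Matrix.mul_assoc, hW.right_orthonormal, Matrix.mul_one]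
    · rw [hW.eq]
      simp only [Matrix.transpose_mul, Matrix.transpose_transpose, Matrix.diagonal_transpose]
      rw [Matrix.mul_assoc, Matrix.mul_assoc, hW.left_orthonormal, Matrix.mul_one]
  obtain ⟨k1, k2⟩ := key hX
  obtain ⟨k1', k2'⟩ := key hX'
  have k3 : Matrix.diagonal s * V.transpose = U.transpose * X := by
    have := congrArg Matrix.transpose k2
    simpa using this.symm
  have hXX : X * V' * V'.transpose = X := by rw [k1', ← hX'.eq]
  have hQ2 : Matrix.diagonal s * (Matrix.diagonal s * (V.transpose * V'))
      = V.transpose * V' * Matrix.diagonal s' * Matrix.diagonal s' := by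
    have e1 : Matrix.diagonal s * (Matrix.diagonal s * (V.transpose * V'))
        = V.transpose * (X.transpose * (X * V')) := by
      rw [← Matrix.mul_assoc (Matrix.diagonal s) V.transpose V', k3, Matrix.mul_assoc,
        ← Matrix.mul_assoc, ← Matrix.mul_assoc V.transpose]
      congr 1
      have := congrArg Matrix.transpose k1
      simpa using this.symm
    rw [e1, k1', ← Matrix.mul_assoc X.transpose, k2']
    simp only [Matrix.mul_assoc]
  have hQ : Matrix.diagonal (fun i => g (s i)) * (V.transpose * V')
      = V.transpose * V' * Matrix.diagonal (fun i => g (s' i)) := by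
    ext i j
    have h1 := congrFun (congrFun hQ2 i) j
    simp only [Matrix.diagonal_mul, Matrix.mul_diagonal] at h1 ⊢
    by_cases h0 : (V.transpose * V') i j = 0
    · simp [h0]
    · have h2 : s i ^ 2 = s' j ^ 2 := by
        apply mul_right_cancel₀ h0
        linarith
      have h3 : s i = s' j := by
        rwa [sq_eq_sq₀ (hX.nonneg i) (hX'.nonneg j)] at h2
      rw [h3, mul_comm]
  symm
  calc U * Matrix.diagonal (fun i => scalarClip c (s i)) * V.transpose
      = U * (Matrix.diagonal (fun i => g (s i)) * (Matrix.diagonal s * V.transpose)) := by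
        rw [hd, hd']; simp only [Matrix.mul_assoc]
    _ = U * (Matrix.diagonal (fun i => g (s i)) *
          (Matrix.diagonal s * V.transpose * V' * V'.transpose)) := by
        congr 2
        rw [k3, Matrix.mul_assoc U.transpose X, Matrix.mul_assoc U.transpose, hXX]
    _ = U * (Matrix.diagonal s * (Matrix.diagonal (fun i => g (s i)) * (V.transpose * V')) *
          V'.transpose) := by
        rw [← Matrix.mul_assoc (Matrix.diagonal s), hd']; simp only [Matrix.mul_assoc]
    _ = U * Matrix.diagonal s * V.transpose * V' * Matrix.diagonal (fun i => g (s' i)) *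
          V'.transpose := by
        rw [hQ]; simp only [Matrix.mul_assoc]
    _ = U' * Matrix.diagonal (fun i => scalarClip c (s' i)) * V'.transpose := by
        rw [← hX.eq, k1', hd]; simp only [Matrix.mul_assoc]

/-- The (entrywise product, equivalently Borel) σ-algebra on real matrices. -/
instance matrixMeasurableSpace {m n : ℕ} : MeasurableSpace (Matrix (Fin m) (Fin n) ℝ) :=
  inferInstanceAs (MeasurableSpace (Fin m → Fin n → ℝ))

/-- The entrywise expectation of a random matrix. -/
noncomputable def matrixExpectation {Ω : Type*} [MeasurableSpace Ω] (P : Measure Ω) {m n : ℕ}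
    (A : Ω → Matrix (Fin m) (Fin n) ℝ) : Matrix (Fin m) (Fin n) ℝ :=
  Matrix.of fun i j => ∫ ω, A ω i j ∂P

/-- `U` is a zero-mean random `d × r` matrix with (almost surely) orthonormal columns, of bounded
anisotropy with parameter `κ > 0`: `E[U Uᵀ] ≼ (κ r / d) I_d` in the Loewner order. The entries of
`U` are almost surely bounded by `1`, so that all the expectations exist. -/
structure HasBoundedAnisotropy {Ω : Type*} [MeasurableSpace Ω] (P : Measure Ω) {d r : ℕ}
    (U : Ω → Matrix (Fin d) (Fin r) ℝ) (κ : ℝ) : Prop where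
  measurable : Measurable U
  mean_zero : matrixExpectation P U = 0
  orthonormal : ∀ᵐ ω ∂P, (U ω).transpose * U ω = 1
  pos : 0 < κ
  anisotropy : ((κ * r / d) • (1 : Matrix (Fin d) (Fin d) ℝ) -
    matrixExpectation P (fun ω => U ω * (U ω).transpose)).PosSemidef

/-! Spectral clipping is the Frobenius projection onto the convex ball {‖Z‖₂ ≤ c}
(`frobInner_sub_spectralClip_nonpos`), hence nonexpansive. This allows the clipped matrix to be
compared with an explicit one, without perturbation theory for singular vectors.

Alignment. Let G' = (1 − UUᵀ)G(1 − VVᵀ). It is orthogonal to UVᵀ on both sides, so G' + ℓUVᵀ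
projects to G' + tUVᵀ with t = min(ℓ, c); here c ≥ ‖G‖₂ keeps G' inside the ball. By
nonexpansiveness, replacing G by G' moves the clipped matrix by at most ‖G − G'‖_F, and ‖G − G'‖_F²
≤ E := ‖UᵀG‖_F² + ‖GV‖_F². Two uses of Young's inequality give ⟨G, g̃⟩ ≥ ‖G‖_F²/2 − 2E + t⟨G, UVᵀ⟩
(`le_frobInner_spectralClip`). The last term has mean zero by independence, and bounded anisotropy
gives 𝔼E ≤ (2/25)‖G‖_F².

Energy. This bound holds pointwise (`frobInner_spectralClip_perturbation_le`). Weight the i-th right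
singular vector of g by the share pᵢ of its squared length in the range of V. The shares sum to at
most r and are charged at the largest clipped singular value; the remaining energy is at most ‖g(1 −
VVᵀ)‖_F² = ‖G(1 − VVᵀ)‖_F² ≤ ‖G‖_F². -/

/-! ### Algebra of the Frobenius inner product -/

theorem frobInner_eq_sum {m n : ℕ} (A B : Matrix (Fin m) (Fin n) ℝ) :
    frobInner A B = ∑ i, ∑ j, A i j * B i j := by
  simp only [frobInner, Matrix.trace, Matrix.diag, Matrix.mul_apply, Matrix.transpose_apply]
  exact Finset.sum_comm

theorem frobNorm_sq {m n : ℕ} (A : Matrix (Fin m) (Fin n) ℝ) :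
    frobNorm A ^ 2 = frobInner A A := by
  have h0 : 0 ≤ ∑ i, ∑ j, ‖A i j‖ ^ (2 : ℝ) := by positivity
  rw [frobInner_eq_sum, frobNorm, Matrix.frobenius_norm_def, ← Real.sqrt_eq_rpow, Real.sq_sqrt h0]
  simp [sq]

theorem frobInner_comm {m n : ℕ} (A B : Matrix (Fin m) (Fin n) ℝ) :
    frobInner A B = frobInner B A := by
  simp only [frobInner_eq_sum, mul_comm]

theorem frobInner_self_nonneg {m n : ℕ} (A : Matrix (Fin m) (Fin n) ℝ) : 0 ≤ frobInner A A := by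
  rw [← frobNorm_sq]; positivity

theorem frobInner_add_left {m n : ℕ} (A B C : Matrix (Fin m) (Fin n) ℝ) :
    frobInner (A + B) C = frobInner A C + frobInner B C := by
  simp [frobInner, Matrix.add_mul]

theorem frobInner_add_right {m n : ℕ} (A B C : Matrix (Fin m) (Fin n) ℝ) :
    frobInner A (B + C) = frobInner A B + frobInner A C := by
  simp [frobInner, Matrix.mul_add]

theorem frobInner_sub_left {m n : ℕ} (A B C : Matrix (Fin m) (Fin n) ℝ) :
    frobInner (A - B) C = frobInner A C - frobInner B C := by
  simp [frobInner, Matrix.sub_mul]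

theorem frobInner_sub_right {m n : ℕ} (A B C : Matrix (Fin m) (Fin n) ℝ) :
    frobInner A (B - C) = frobInner A B - frobInner A C := by
  simp [frobInner, Matrix.mul_sub]

theorem frobInner_smul_left {m n : ℕ} (a : ℝ) (A B : Matrix (Fin m) (Fin n) ℝ) :
    frobInner (a • A) B = a * frobInner A B := by
  simp [frobInner]

theorem frobInner_smul_right {m n : ℕ} (a : ℝ) (A B : Matrix (Fin m) (Fin n) ℝ) :
    frobInner A (a • B) = a * frobInner A B := by
  simp [frobInner]

theorem frobInner_mul_left {m k n : ℕ} (U : Matrix (Fin m) (Fin k) ℝ) (A : Matrix (Fin k) (Fin n) ℝ)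
    (B : Matrix (Fin m) (Fin n) ℝ) :
    frobInner (U * A) B = frobInner A (U.transpose * B) := by
  simp [frobInner, Matrix.transpose_mul, Matrix.mul_assoc]

theorem frobInner_mul_transpose_left {m k n : ℕ} (V : Matrix (Fin n) (Fin k) ℝ)
    (A : Matrix (Fin m) (Fin k) ℝ) (B : Matrix (Fin m) (Fin n) ℝ) :
    frobInner (A * V.transpose) B = frobInner A (B * V) := by
  simp only [frobInner, Matrix.transpose_mul, Matrix.transpose_transpose]
  rw [Matrix.mul_assoc, Matrix.trace_mul_comm, Matrix.mul_assoc]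

theorem frobInner_transpose {m n : ℕ} (A B : Matrix (Fin m) (Fin n) ℝ) :
    frobInner A.transpose B.transpose = frobInner A B := by
  simp only [frobInner_eq_sum, Matrix.transpose_apply]
  exact Finset.sum_comm

theorem frobInner_diagonal {k : ℕ} (d : Fin k → ℝ) (A : Matrix (Fin k) (Fin k) ℝ) :
    frobInner (Matrix.diagonal d) A = ∑ i, d i * A i i := by
  simp [frobInner, Matrix.trace, Matrix.diagonal_mul]

/-- Young's inequality for the Frobenius inner product. -/
theorem abs_frobInner_le {m n : ℕ} (A B : Matrix (Fin m) (Fin n) ℝ) :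
    |frobInner A B| ≤ frobInner A A / 4 + frobInner B B := by
  have h1 := frobInner_self_nonneg ((1 / 2 : ℝ) • A - B)
  have h2 := frobInner_self_nonneg ((1 / 2 : ℝ) • A + B)
  simp only [frobInner_sub_left, frobInner_sub_right, frobInner_add_left, frobInner_add_right,
    frobInner_smul_left, frobInner_smul_right, frobInner_comm B A] at h1 h2
  rw [abs_le]
  constructor <;> linarith

/-- Removing the component in the range of an isometry `U`. -/
theorem frobInner_sub_proj_self {m k n : ℕ} {U : Matrix (Fin m) (Fin k) ℝ}
    (hU : U.transpose * U = 1) (W : Matrix (Fin m) (Fin n) ℝ) :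
    frobInner (W - U * (U.transpose * W)) (W - U * (U.transpose * W)) =
      frobInner W W - frobInner (U.transpose * W) (U.transpose * W) := by
  have h1 : frobInner (U * (U.transpose * W)) W =
      frobInner (U.transpose * W) (U.transpose * W) := frobInner_mul_left _ _ _
  have h2 : frobInner (U * (U.transpose * W)) (U * (U.transpose * W)) =
      frobInner (U.transpose * W) (U.transpose * W) := by
    rw [frobInner_mul_left, ← Matrix.mul_assoc, hU, Matrix.one_mul]
  simp only [frobInner_sub_left, frobInner_sub_right, frobInner_comm W, h1, h2]
  ring

theorem frobInner_transpose_mul_le {m k n : ℕ} {U : Matrix (Fin m) (Fin k) ℝ}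
    (hU : U.transpose * U = 1) (W : Matrix (Fin m) (Fin n) ℝ) :
    frobInner (U.transpose * W) (U.transpose * W) ≤ frobInner W W := by
  have := frobInner_self_nonneg (W - U * (U.transpose * W))
  rw [frobInner_sub_proj_self hU] at this
  linarith

theorem frobInner_mul_le {m k n : ℕ} {V : Matrix (Fin n) (Fin k) ℝ}
    (hV : V.transpose * V = 1) (W : Matrix (Fin m) (Fin n) ℝ) :
    frobInner (W * V) (W * V) ≤ frobInner W W := by
  have := frobInner_transpose_mul_le hV W.transpose
  rwa [← Matrix.transpose_mul, frobInner_transpose, frobInner_transpose] at this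

/-! ### The spectral-norm ball through bilinear forms -/

theorem dotProduct_self_nonneg_real {k : ℕ} (a : Fin k → ℝ) : 0 ≤ a ⬝ᵥ a :=
  Finset.sum_nonneg fun _ _ => mul_self_nonneg _

/-- Pythagoras for the decomposition along an isometry. -/
theorem dotProduct_sub_proj_self {m k : ℕ} {U : Matrix (Fin m) (Fin k) ℝ}
    (hU : U.transpose * U = 1) (u : Fin m → ℝ) :
    (u - U.mulVec (U.transpose.mulVec u)) ⬝ᵥ (u - U.mulVec (U.transpose.mulVec u)) =
      u ⬝ᵥ u - U.transpose.mulVec u ⬝ᵥ U.transpose.mulVec u := by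
  have h1 : U.mulVec (U.transpose.mulVec u) ⬝ᵥ u =
      U.transpose.mulVec u ⬝ᵥ U.transpose.mulVec u := by
    rw [dotProduct_comm, Matrix.dotProduct_mulVec, ← Matrix.mulVec_transpose]
  have h2 : U.mulVec (U.transpose.mulVec u) ⬝ᵥ U.mulVec (U.transpose.mulVec u) =
      U.transpose.mulVec u ⬝ᵥ U.transpose.mulVec u := by
    rw [Matrix.dotProduct_mulVec, ← Matrix.mulVec_transpose, Matrix.mulVec_mulVec, hU,
      Matrix.one_mulVec]
  simp only [sub_dotProduct, dotProduct_sub, dotProduct_comm u, h1, h2]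
  ring

/-- Bessel's inequality for the orthonormal columns of `U`. -/
theorem dotProduct_transpose_mulVec_le {m k : ℕ} {U : Matrix (Fin m) (Fin k) ℝ}
    (hU : U.transpose * U = 1) (u : Fin m → ℝ) :
    U.transpose.mulVec u ⬝ᵥ U.transpose.mulVec u ≤ u ⬝ᵥ u := by
  have h := dotProduct_self_nonneg_real (u - U.mulVec (U.transpose.mulVec u))
  rw [dotProduct_sub_proj_self hU] at h
  linarith

/-- `Z` lies in the spectral-norm ball of radius `c`, expressed through its bilinear form. -/
def InSpecBall {m n : ℕ} (c : ℝ) (Z : Matrix (Fin m) (Fin n) ℝ) : Prop :=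
  ∀ u v, 2 * (u ⬝ᵥ Z.mulVec v) ≤ c * (u ⬝ᵥ u + v ⬝ᵥ v)

theorem two_mul_dotProduct_le {k : ℕ} (a b : Fin k → ℝ) : 2 * (a ⬝ᵥ b) ≤ a ⬝ᵥ a + b ⬝ᵥ b := by
  simp only [dotProduct, Finset.mul_sum, ← Finset.sum_add_distrib]
  exact Finset.sum_le_sum fun i _ => by nlinarith [sq_nonneg (a i - b i)]

theorem specNorm_nonneg {m n : ℕ} (A : Matrix (Fin m) (Fin n) ℝ) : 0 ≤ specNorm A :=
  @norm_nonneg _ Matrix.instL2OpNormedAddCommGroup.toSeminormedAddCommGroup.toSeminormedAddGroup A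

theorem inSpecBall_specNorm {m n : ℕ} (A : Matrix (Fin m) (Fin n) ℝ) :
    InSpecBall (specNorm A) A := by
  intro u v
  have h1 : ‖WithLp.toLp 2 (A.mulVec v)‖ ≤ specNorm A * ‖WithLp.toLp 2 v‖ :=
    Matrix.l2_opNorm_mulVec A (WithLp.toLp 2 v)
  have h2 := real_inner_le_norm (WithLp.toLp 2 (A.mulVec v)) (WithLp.toLp 2 u)
  have h3 : ∀ {k : ℕ} (w : Fin k → ℝ), w ⬝ᵥ w = ‖WithLp.toLp 2 w‖ ^ 2 := by
    intro k w
    rw [← real_inner_self_eq_norm_sq, EuclideanSpace.inner_eq_star_dotProduct]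
    simp
  rw [EuclideanSpace.inner_eq_star_dotProduct] at h2
  simp only [star_trivial] at h2
  rw [h3, h3]
  have h4 := specNorm_nonneg A
  have h5 := mul_le_mul_of_nonneg_right h1 (norm_nonneg (WithLp.toLp 2 u))
  nlinarith [mul_nonneg h4 (sq_nonneg (‖WithLp.toLp 2 u‖ - ‖WithLp.toLp 2 v‖))]

theorem InSpecBall.mono {m n : ℕ} {c c' : ℝ} {Z : Matrix (Fin m) (Fin n) ℝ}
    (h : InSpecBall c Z) (hc : c ≤ c') : InSpecBall c' Z := fun u v =>
  (h u v).trans (mul_le_mul_of_nonneg_right hc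
    (add_nonneg (dotProduct_self_nonneg_real u) (dotProduct_self_nonneg_real v)))

theorem InSpecBall.add {m n : ℕ} {c c' : ℝ} {Z Z' : Matrix (Fin m) (Fin n) ℝ}
    (h : InSpecBall c Z) (h' : InSpecBall c' Z') : InSpecBall (c + c') (Z + Z') := fun u v => by
  rw [Matrix.add_mulVec, dotProduct_add]
  linarith [h u v, h' u v]

/-- A block-diagonal combination of two elements of the ball lies in the ball. -/
theorem inSpecBall_compression_add {m n r : ℕ} {c t : ℝ} {U : Matrix (Fin m) (Fin r) ℝ}
    {V : Matrix (Fin n) (Fin r) ℝ} (hU : U.transpose * U = 1) (hV : V.transpose * V = 1)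
    {G : Matrix (Fin m) (Fin n) ℝ} (hG : InSpecBall c G) (ht : 0 ≤ t) (htc : t ≤ c) :
    InSpecBall c ((1 - U * U.transpose) * G * (1 - V * V.transpose) + t • (U * V.transpose)) := by
  intro u v
  -- The form of `G` is tested on the components of `u`, `v` orthogonal to the ranges of `U`, `V`;
  -- the `t` part only sees the components inside them, and Pythagoras adds the two budgets.
  have h1 := hG (u - U.mulVec (U.transpose.mulVec u)) (v - V.mulVec (V.transpose.mulVec v))
  rw [dotProduct_sub_proj_self hU, dotProduct_sub_proj_self hV] at h1
  have h2 := two_mul_dotProduct_le (U.transpose.mulVec u) (V.transpose.mulVec v)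
  have h3 : u ⬝ᵥ ((1 - U * U.transpose) * G * (1 - V * V.transpose)
      + t • (U * V.transpose)).mulVec v
      = (u - U.mulVec (U.transpose.mulVec u)) ⬝ᵥ G.mulVec (v - V.mulVec (V.transpose.mulVec v))
        + t * (U.transpose.mulVec u ⬝ᵥ V.transpose.mulVec v) := by
    have e1 : u - U.mulVec (U.transpose.mulVec u) = (1 - U * U.transpose).mulVec u := by
      rw [Matrix.sub_mulVec, Matrix.one_mulVec, Matrix.mulVec_mulVec]
    have e2 : v - V.mulVec (V.transpose.mulVec v) = (1 - V * V.transpose).mulVec v := by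
      rw [Matrix.sub_mulVec, Matrix.one_mulVec, Matrix.mulVec_mulVec]
    have e3 : (1 - U * U.transpose).transpose = 1 - U * U.transpose := by simp
    rw [e1, e2, Matrix.add_mulVec, dotProduct_add, Matrix.smul_mulVec, dotProduct_smul, smul_eq_mul,
      ← Matrix.mulVec_mulVec, ← Matrix.mulVec_mulVec, ← Matrix.mulVec_mulVec,
      Matrix.dotProduct_mulVec u (1 - _), Matrix.dotProduct_mulVec u U, ← Matrix.mulVec_transpose,
      ← Matrix.mulVec_transpose, e3]
  rw [h3]
  have h4 := dotProduct_self_nonneg_real (U.transpose.mulVec u)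
  have h5 := dotProduct_self_nonneg_real (V.transpose.mulVec v)
  nlinarith [mul_le_mul_of_nonneg_left h2 ht,
    mul_le_mul_of_nonneg_right htc (add_nonneg h4 h5)]

/-- In the coordinates a = Uᵀu, b = Vᵀv each term satisfies 2taᵢbᵢ ≤ c(aᵢ² + bᵢ²), where t is the
i-th diagonal entry; Bessel's inequality returns to `u` and `v`. -/
theorem inSpecBall_mul_diagonal_mul {m n k : ℕ} {c : ℝ} {U : Matrix (Fin m) (Fin k) ℝ}
    {V : Matrix (Fin n) (Fin k) ℝ} (hU : U.transpose * U = 1) (hV : V.transpose * V = 1)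
    {t : Fin k → ℝ} (hc : 0 ≤ c) (ht : ∀ i, 0 ≤ t i) (htc : ∀ i, t i ≤ c) :
    InSpecBall c (U * Matrix.diagonal t * V.transpose) := by
  intro u v
  have h1 := dotProduct_transpose_mulVec_le hU u
  have h2 := dotProduct_transpose_mulVec_le hV v
  have h3 : u ⬝ᵥ (U * Matrix.diagonal t * V.transpose).mulVec v =
      ∑ i, U.transpose.mulVec u i * (t i * V.transpose.mulVec v i) := by
    rw [← Matrix.mulVec_mulVec, ← Matrix.mulVec_mulVec, Matrix.dotProduct_mulVec,
      ← Matrix.mulVec_transpose]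
    simp only [dotProduct, Matrix.mulVec_diagonal]
  refine le_trans ?_ (mul_le_mul_of_nonneg_left (add_le_add h1 h2) hc)
  rw [h3]
  simp only [dotProduct, ← Finset.sum_add_distrib, Finset.mul_sum]
  refine Finset.sum_le_sum fun i _ => ?_
  set a := U.transpose.mulVec u i
  set b := V.transpose.mulVec v i
  nlinarith [mul_nonneg (ht i) (sq_nonneg (a - b)),
    mul_nonneg (sub_nonneg.2 (htc i)) (add_nonneg (mul_self_nonneg a) (mul_self_nonneg b))]

/-- The i-th columns of `U` and `V` are unit vectors, so they are admissible test vectors for the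
form of `Z`. -/
theorem InSpecBall.apply_le {m n k : ℕ} {c : ℝ} {Z : Matrix (Fin m) (Fin n) ℝ}
    (hZ : InSpecBall c Z) {U : Matrix (Fin m) (Fin k) ℝ} {V : Matrix (Fin n) (Fin k) ℝ}
    (hU : U.transpose * U = 1) (hV : V.transpose * V = 1) (i : Fin k) :
    (U.transpose * (Z * V)) i i ≤ c := by
  have h1 : ∀ {d : ℕ} {W : Matrix (Fin d) (Fin k) ℝ}, W.transpose * W = 1 →
      (fun a => W a i) ⬝ᵥ (fun a => W a i) = 1 := by
    intro d W hW
    have := congrFun (congrFun hW i) i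
    rwa [Matrix.mul_apply, Matrix.one_apply_eq] at this
  have h2 := hZ (fun a => U a i) (fun a => V a i)
  rw [h1 hU, h1 hV] at h2
  have h3 : (U.transpose * (Z * V)) i i = (fun a => U a i) ⬝ᵥ Z.mulVec (fun a => V a i) := rfl
  rw [h3]
  linarith

/-! ### Spectral clipping as a metric projection -/

theorem scalarClip_of_nonneg {c x : ℝ} (hc : 0 ≤ c) (hx : 0 ≤ x) : scalarClip c x = min x c := by
  rcases hx.eq_or_lt with rfl | hx
  · simp [scalarClip, hc]
  · simp [scalarClip, abs_of_pos hx, sign_pos hx]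

/-- Spectral clipping maps into the spectral-norm ball. -/
theorem inSpecBall_spectralClip {m n : ℕ} {c : ℝ} (hc : 0 ≤ c) (X : Matrix (Fin m) (Fin n) ℝ) :
    InSpecBall c (spectralClip c X) := by
  obtain ⟨U, s, V, h⟩ := exists_isCompactSVD X
  rw [spectralClip_eq c h]
  simp only [scalarClip_of_nonneg hc (h.nonneg _)]
  exact inSpecBall_mul_diagonal_mul h.left_orthonormal h.right_orthonormal hc
    (fun i => le_min (h.nonneg i) hc) (fun i => min_le_right _ _)

/-- Spectral clipping is the Frobenius projection onto the spectral-norm ball: the variational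
inequality. -/
theorem frobInner_sub_spectralClip_nonpos {m n : ℕ} {c : ℝ} (hc : 0 ≤ c)
    (X : Matrix (Fin m) (Fin n) ℝ) {Z : Matrix (Fin m) (Fin n) ℝ} (hZ : InSpecBall c Z) :
    frobInner (X - spectralClip c X) (Z - spectralClip c X) ≤ 0 := by
  obtain ⟨U, s, V, h⟩ := exists_isCompactSVD X
  rw [spectralClip_eq c h]
  simp only [scalarClip_of_nonneg hc (h.nonneg _)]
  set t : Fin (min m n) → ℝ := fun i => min (s i) c
  have h1 : X - U * Matrix.diagonal t * V.transpose =
      U * Matrix.diagonal (fun i => s i - t i) * V.transpose := by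
    conv_lhs => rw [h.eq]
    rw [← Matrix.diagonal_sub, Matrix.mul_sub, Matrix.sub_mul]
  have h2 : U.transpose * ((U * Matrix.diagonal t * V.transpose) * V) = Matrix.diagonal t := by
    rw [Matrix.mul_assoc _ V.transpose, h.right_orthonormal, Matrix.mul_one, ← Matrix.mul_assoc,
      h.left_orthonormal, Matrix.one_mul]
  rw [h1, frobInner_mul_transpose_left, frobInner_mul_left, Matrix.sub_mul, Matrix.mul_sub, h2,
    frobInner_diagonal]
  refine Finset.sum_nonpos fun i _ => ?_
  have h3 := hZ.apply_le h.left_orthonormal h.right_orthonormal i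
  rw [Matrix.sub_apply, Matrix.diagonal_apply_eq]
  -- Complementary slackness: an unclipped singular value leaves no residual, and at a clipped one
  -- the residual `s i - c` meets a diagonal entry of `Z` that is at most `c`.
  rcases le_total (s i) c with hs | hs
  · simp [t, hs]
  · simp only [t, min_eq_right hs]
    exact mul_nonpos_of_nonneg_of_nonpos (by linarith) (by linarith)

/-- Two points satisfying the variational inequalities of a projection are no further apart than
their preimages. -/
theorem frobInner_sub_le_of_variational {m n : ℕ} {X X' Y Y' : Matrix (Fin m) (Fin n) ℝ}
    (h : frobInner (X - Y) (Y' - Y) ≤ 0) (h' : frobInner (X' - Y') (Y - Y') ≤ 0) :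
    frobInner (Y - Y') (Y - Y') ≤ frobInner (X - X') (X - X') := by
  -- With D = X − X' and F = Y − Y', the two hypotheses add up to ‖F‖² ≤ ⟨D, F⟩, and ‖D − F‖² ≥ 0
  -- turns this into ‖F‖² ≤ ‖D‖².
  have h1 := frobInner_self_nonneg (X - X' - (Y - Y'))
  simp only [frobInner_sub_left, frobInner_sub_right, frobInner_comm X' X, frobInner_comm Y X,
    frobInner_comm Y' X, frobInner_comm Y X', frobInner_comm Y' X', frobInner_comm Y' Y]
    at h h' h1 ⊢
  linarith

/-- Continuity comes from the nonexpansiveness of the projection, which bypasses the discontinuous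
choice of singular vectors. It supplies the measurability of the clipped random matrix. -/
theorem continuous_spectralClip_apply {m n : ℕ} {c : ℝ} (hc : 0 ≤ c) (i : Fin m) (j : Fin n) :
    Continuous fun X : Fin m → Fin n → ℝ => spectralClip c (Matrix.of X) i j := by
  rw [continuous_iff_continuousAt]
  intro X₀
  rw [ContinuousAt, tendsto_iff_dist_tendsto_zero]
  have hf : Continuous fun X : Fin m → Fin n → ℝ =>
      Real.sqrt (∑ a, ∑ b, (X a b - X₀ a b) * (X a b - X₀ a b)) := by fun_prop
  have hf0 := hf.tendsto X₀
  simp only [sub_self, mul_zero, Finset.sum_const_zero, Real.sqrt_zero] at hf0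
  refine squeeze_zero (fun _ => dist_nonneg) (fun X => ?_) hf0
  have h1 := frobInner_sub_le_of_variational
    (frobInner_sub_spectralClip_nonpos hc (Matrix.of X)
      (inSpecBall_spectralClip hc (Matrix.of X₀)))
    (frobInner_sub_spectralClip_nonpos hc (Matrix.of X₀)
      (inSpecBall_spectralClip hc (Matrix.of X)))
  rw [frobInner_eq_sum, frobInner_eq_sum] at h1
  rw [Real.dist_eq]
  refine Real.abs_le_sqrt (le_trans ?_ h1)
  rw [sq]
  refine le_trans ?_ (Finset.single_le_sum (f := fun a => ∑ b,
    (spectralClip c (Matrix.of X) - spectralClip c (Matrix.of X₀)) a b *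
    (spectralClip c (Matrix.of X) - spectralClip c (Matrix.of X₀)) a b)
    (fun a _ => Finset.sum_nonneg fun b _ => mul_self_nonneg _) (Finset.mem_univ i))
  exact Finset.single_le_sum (f := fun b =>
    (spectralClip c (Matrix.of X) - spectralClip c (Matrix.of X₀)) i b *
    (spectralClip c (Matrix.of X) - spectralClip c (Matrix.of X₀)) i b)
    (fun b _ => mul_self_nonneg _) (Finset.mem_univ j)

theorem measurable_spectralClip_apply {m n : ℕ} {c : ℝ} (hc : 0 ≤ c) (i : Fin m) (j : Fin n) :
    Measurable fun X : Matrix (Fin m) (Fin n) ℝ => spectralClip c X i j :=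
  (continuous_spectralClip_apply hc i j).measurable

theorem frobInner_spectralClip_self {m n : ℕ} {c : ℝ} (hc : 0 ≤ c)
    {X : Matrix (Fin m) (Fin n) ℝ} {U : Matrix (Fin m) (Fin (min m n)) ℝ}
    {s : Fin (min m n) → ℝ} {V : Matrix (Fin n) (Fin (min m n)) ℝ} (h : IsCompactSVD X U s V) :
    frobInner (spectralClip c X) (spectralClip c X) = ∑ i, min (s i) c ^ 2 := by
  rw [spectralClip_eq c h]
  simp only [scalarClip_of_nonneg hc (h.nonneg _)]
  rw [frobInner_mul_transpose_left, frobInner_mul_left,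
    Matrix.mul_assoc _ V.transpose, h.right_orthonormal, Matrix.mul_one, ← Matrix.mul_assoc,
    h.left_orthonormal, Matrix.one_mul, frobInner_diagonal]
  simp [sq]

theorem frobInner_spectralClip_self_le {m n : ℕ} {c : ℝ} (hc : 0 ≤ c)
    (X : Matrix (Fin m) (Fin n) ℝ) :
    frobInner (spectralClip c X) (spectralClip c X) ≤ (min m n : ℕ) * c ^ 2 := by
  obtain ⟨U, s, V, h⟩ := exists_isCompactSVD X
  rw [frobInner_spectralClip_self hc h]
  calc ∑ i, min (s i) c ^ 2 ≤ ∑ _i : Fin (min m n), c ^ 2 :=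
        Finset.sum_le_sum fun i _ =>
          pow_le_pow_left₀ (le_min (h.nonneg i) hc) (min_le_right _ _) 2
    _ = _ := by simp

/-! ### Pointwise bounds for a clipped low-rank perturbation -/

theorem frobInner_add_sub_proj_self {m n k : ℕ} {U : Matrix (Fin m) (Fin k) ℝ}
    (hU : U.transpose * U = 1) (A : Matrix (Fin k) (Fin n) ℝ) (W : Matrix (Fin m) (Fin n) ℝ) :
    frobInner (U * A + (W - U * (U.transpose * W))) (U * A + (W - U * (U.transpose * W))) =
      frobInner A A + frobInner (W - U * (U.transpose * W)) (W - U * (U.transpose * W)) := by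
  have h1 : frobInner (U * A) (U * A) = frobInner A A := by
    rw [frobInner_mul_left, ← Matrix.mul_assoc, hU, Matrix.one_mul]
  have h2 : frobInner (U * A) (W - U * (U.transpose * W)) = 0 := by
    rw [frobInner_mul_left, Matrix.mul_sub, ← Matrix.mul_assoc U.transpose U, hU, Matrix.one_mul,
      sub_self]
    simp [frobInner]
  rw [frobInner_add_left, frobInner_add_right, frobInner_add_right, h1, h2,
    frobInner_comm (W - _) (U * A), h2]
  ring

/-- The part of `G` removed by compressing it to the complements of the ranges of `U` and `V`. -/
theorem frobInner_sub_compression_self_le {m n r : ℕ} {U : Matrix (Fin m) (Fin r) ℝ}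
    {V : Matrix (Fin n) (Fin r) ℝ} (hU : U.transpose * U = 1) (hV : V.transpose * V = 1)
    (G : Matrix (Fin m) (Fin n) ℝ) :
    frobInner (G - (1 - U * U.transpose) * G * (1 - V * V.transpose))
        (G - (1 - U * U.transpose) * G * (1 - V * V.transpose)) ≤
      frobInner (U.transpose * G) (U.transpose * G) + frobInner (G * V) (G * V) := by
  -- The removed part is UUᵀG + (1 − UUᵀ)GVVᵀ, two orthogonal pieces.
  have h1 : G - (1 - U * U.transpose) * G * (1 - V * V.transpose) =
      U * (U.transpose * G) +
        (G * V * V.transpose - U * (U.transpose * (G * V * V.transpose))) := by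
    simp only [Matrix.sub_mul, Matrix.mul_sub, Matrix.one_mul, Matrix.mul_one, Matrix.mul_assoc]
    abel
  have h2 : frobInner (G * V * V.transpose) (G * V * V.transpose) = frobInner (G * V) (G * V) := by
    rw [frobInner_mul_transpose_left, Matrix.mul_assoc (G * V), hV, Matrix.mul_one]
  rw [h1, frobInner_add_sub_proj_self hU, frobInner_sub_proj_self hU, h2]
  linarith [frobInner_self_nonneg (U.transpose * (G * V * V.transpose))]

/-- This is the variational inequality certifying G' + tUVᵀ as the projection of G' + ℓUVᵀ, where G'
is the compression of `G`. Since G'V = 0, only the diagonal of Uᵀ`Z`V − t·1 matters: its entries are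
nonpositive if t = c, and otherwise the factor ℓ − t vanishes. -/
theorem frobInner_mul_transpose_sub_nonpos {m n r : ℕ} {c t ℓ : ℝ} {U : Matrix (Fin m) (Fin r) ℝ}
    {V : Matrix (Fin n) (Fin r) ℝ} (hU : U.transpose * U = 1) (hV : V.transpose * V = 1)
    (G : Matrix (Fin m) (Fin n) ℝ) (ht : t = min ℓ c) {Z : Matrix (Fin m) (Fin n) ℝ}
    (hZ : InSpecBall c Z) :
    frobInner ((ℓ - t) • (U * V.transpose))
      (Z - ((1 - U * U.transpose) * G * (1 - V * V.transpose) + t • (U * V.transpose))) ≤ 0 := by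
  have h1 : U.transpose * ((Z - ((1 - U * U.transpose) * G * (1 - V * V.transpose) +
      t • (U * V.transpose))) * V) = U.transpose * (Z * V) - t • 1 := by
    have e1 : (1 - V * V.transpose) * V = 0 := by
      rw [Matrix.sub_mul, Matrix.one_mul, Matrix.mul_assoc, hV, Matrix.mul_one, sub_self]
    rw [Matrix.sub_mul, Matrix.add_mul, Matrix.mul_assoc _ (1 - V * V.transpose), e1,
      Matrix.mul_zero, zero_add, Matrix.mul_sub, Matrix.smul_mul, Matrix.mul_assoc U, hV,
      Matrix.mul_one, Matrix.mul_smul, hU]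
  have h2 : U * V.transpose = U * Matrix.diagonal (fun _ : Fin r => (1 : ℝ)) * V.transpose := by
    rw [Matrix.diagonal_one, Matrix.mul_one]
  rw [frobInner_smul_left]
  nth_rw 1 [h2]
  rw [frobInner_mul_transpose_left, frobInner_mul_left, h1, frobInner_diagonal]
  subst ht
  rcases le_total ℓ c with h | h
  · simp [h]
  · rw [min_eq_right h]
    refine mul_nonpos_of_nonneg_of_nonpos (by linarith) (Finset.sum_nonpos fun i _ => ?_)
    have := hZ.apply_le hU hV i
    simpa using this

/-- Pointwise lower bound for the alignment of `G` with the clipped perturbation of `G`. -/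
theorem le_frobInner_spectralClip {m n r : ℕ} {c ℓ : ℝ} (hc : 0 ≤ c) (hℓ : 0 ≤ ℓ)
    {U : Matrix (Fin m) (Fin r) ℝ} {V : Matrix (Fin n) (Fin r) ℝ}
    (hU : U.transpose * U = 1) (hV : V.transpose * V = 1)
    {G : Matrix (Fin m) (Fin n) ℝ} (hG : InSpecBall c G) :
    frobInner G G / 2 - 2 * (frobInner (U.transpose * G) (U.transpose * G) +
        frobInner (G * V) (G * V)) + min ℓ c * frobInner G (U * V.transpose) ≤
      frobInner G (spectralClip c (G + ℓ • (U * V.transpose))) := by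
  set t := min ℓ c with ht
  set G' := (1 - U * U.transpose) * G * (1 - V * V.transpose) with hG'
  set X := G + ℓ • (U * V.transpose) with hX
  have hY := inSpecBall_compression_add hU hV hG (le_min hℓ hc) (min_le_right ℓ c)
  rw [← ht, ← hG'] at hY
  have hE := frobInner_sub_compression_self_le hU hV G
  rw [← hG'] at hE
  have h2 := frobInner_mul_transpose_sub_nonpos hU hV G ht (inSpecBall_spectralClip hc X)
  rw [← hG'] at h2
  have e1 : (G' + ℓ • (U * V.transpose)) - (G' + t • (U * V.transpose)) =
      (ℓ - t) • (U * V.transpose) := by rw [sub_smul]; abel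
  have e2 : X - (G' + ℓ • (U * V.transpose)) = G - G' := by rw [hX]; abel
  rw [← e1] at h2
  have h3 := frobInner_sub_le_of_variational (frobInner_sub_spectralClip_nonpos hc X hY) h2
  rw [e2] at h3
  -- Each of the two Young inequalities costs ‖G‖²/4 plus at most ‖UᵀG‖² + ‖GV‖²: one for the
  -- displacement of the clipped matrix, one for ⟨G, G − G'⟩.
  have h4 := neg_le_of_abs_le
    (abs_frobInner_le G (spectralClip c X - (G' + t • (U * V.transpose))))
  have h5 := le_of_abs_le (abs_frobInner_le G (G - G'))
  rw [frobInner_sub_right G, frobInner_add_right, frobInner_smul_right] at h4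
  rw [frobInner_sub_right G] at h5
  linarith

/-- Pointwise bound for the energy of the clipped rank-`r` perturbation of `G`. -/
theorem frobInner_spectralClip_perturbation_le {m n r : ℕ} {c ℓ M : ℝ} (hc : 0 ≤ c) (hℓ : 0 ≤ ℓ)
    {U : Matrix (Fin m) (Fin r) ℝ} {V : Matrix (Fin n) (Fin r) ℝ}
    (hU : U.transpose * U = 1) (hV : V.transpose * V = 1)
    {G : Matrix (Fin m) (Fin n) ℝ} {b : ℝ} (hG : InSpecBall b G)
    (hM : M = min c (ℓ + b)) :
    frobInner (spectralClip c (G + ℓ • (U * V.transpose)))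
      (spectralClip c (G + ℓ • (U * V.transpose))) ≤ r * M ^ 2 + frobInner G G := by
  set X := G + ℓ • (U * V.transpose) with hX
  obtain ⟨A, s, W, h⟩ := exists_isCompactSVD X
  rw [frobInner_spectralClip_self hc h]
  have hball : InSpecBall (b + ℓ) X := by
    refine hG.add ?_
    have := inSpecBall_mul_diagonal_mul hU hV hℓ (t := fun _ => ℓ) (fun _ => hℓ) (fun _ => le_rfl)
    rwa [← Matrix.smul_one_eq_diagonal, Matrix.mul_smul, Matrix.mul_one, Matrix.smul_mul] at this
  have hs : ∀ i, s i ≤ b + ℓ := by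
    intro i
    have h1 := hball.apply_le h.left_orthonormal h.right_orthonormal i
    rw [h.eq, Matrix.mul_assoc _ W.transpose, h.right_orthonormal, Matrix.mul_one,
      ← Matrix.mul_assoc, h.left_orthonormal, Matrix.one_mul, Matrix.diagonal_apply_eq] at h1
    exact h1
  -- `p i` is the squared length of the projection of the i-th right singular vector onto the range
  -- of `V`.
  set p : Fin (min m n) → ℝ := fun i => ∑ j, (V.transpose * W) j i ^ 2 with hp
  have hp0 : ∀ i, 0 ≤ p i := fun i => Finset.sum_nonneg fun j _ => sq_nonneg _
  have hp1 : ∀ i, p i ≤ 1 := by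
    intro i
    have h1 := dotProduct_transpose_mulVec_le hV (fun a => W a i)
    have h2 := congrFun (congrFun h.right_orthonormal i) i
    rw [Matrix.mul_apply, Matrix.one_apply_eq] at h2
    calc p i = V.transpose.mulVec (fun a => W a i) ⬝ᵥ V.transpose.mulVec (fun a => W a i) := by
          simp only [hp, sq]; rfl
      _ ≤ _ := h1
      _ = 1 := h2
  have hpr : ∑ i, p i ≤ r := by
    have h1 := frobInner_mul_le h.right_orthonormal V.transpose
    rw [frobInner_transpose] at h1
    have h2 : frobInner V V = r := by
      simp [frobInner, hV]
    rw [h2, frobInner_eq_sum, Finset.sum_comm] at h1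
    simpa only [hp, sq] using h1
  have hXX : frobInner X X = ∑ i, s i ^ 2 := by
    nth_rw 1 [h.eq]
    rw [frobInner_mul_transpose_left, frobInner_mul_left, h.eq,
      Matrix.mul_assoc _ W.transpose, h.right_orthonormal, Matrix.mul_one, ← Matrix.mul_assoc,
      h.left_orthonormal, Matrix.one_mul, frobInner_diagonal]
    simp [sq]
  have hXV : frobInner (X * V) (X * V) = ∑ i, s i ^ 2 * p i := by
    have e1 : X * V = A * (Matrix.diagonal s * (W.transpose * V)) := by
      conv_lhs => rw [h.eq]
      simp only [Matrix.mul_assoc]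
    rw [e1, frobInner_mul_left, ← Matrix.mul_assoc A.transpose, h.left_orthonormal,
      Matrix.one_mul, frobInner_eq_sum]
    refine Finset.sum_congr rfl fun i _ => ?_
    rw [hp, Finset.mul_sum]
    refine Finset.sum_congr rfl fun j _ => ?_
    have e2 : (W.transpose * V) i j = (V.transpose * W) j i := by
      simp only [Matrix.mul_apply, Matrix.transpose_apply, mul_comm]
    rw [Matrix.diagonal_mul, e2]
    ring
  -- Both sides are energies on the orthogonal complement of the range of `V`, where the
  -- perturbation vanishes.
  have hdiff : frobInner X X - frobInner (X * V) (X * V) =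
      frobInner G G - frobInner (G * V) (G * V) := by
    have e1 : X * V = G * V + ℓ • U := by
      rw [hX, Matrix.add_mul, Matrix.smul_mul, Matrix.mul_assoc, hV, Matrix.mul_one]
    have e2 : frobInner (U * V.transpose) G = frobInner U (G * V) := frobInner_mul_transpose_left ..
    have e3 : frobInner (U * V.transpose) (U * V.transpose) = frobInner U U := by
      rw [frobInner_mul_transpose_left, Matrix.mul_assoc, hV, Matrix.mul_one]
    rw [e1, hX]
    simp only [frobInner_add_left, frobInner_add_right, frobInner_smul_left, frobInner_smul_right,
      frobInner_comm G (U * V.transpose), frobInner_comm (G * V) U, e2, e3]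
    ring
  -- The bounds `s i ^ 2` and `M ^ 2` on the clipped square are averaged with weights `1 - p i` and
  -- `p i`.
  have hterm : ∀ i, min (s i) c ^ 2 ≤ (s i ^ 2 - s i ^ 2 * p i) + M ^ 2 * p i := by
    intro i
    have h0 : 0 ≤ min (s i) c := le_min (h.nonneg i) hc
    have h1 : min (s i) c ^ 2 ≤ s i ^ 2 := pow_le_pow_left₀ h0 (min_le_left _ _) 2
    have h2 : min (s i) c ^ 2 ≤ M ^ 2 := by
      refine pow_le_pow_left₀ h0 ?_ 2
      rw [hM]
      exact le_min (min_le_right _ _) ((min_le_left _ _).trans ((hs i).trans_eq (add_comm _ _)))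
    nlinarith [mul_le_mul_of_nonneg_right h1 (sub_nonneg.2 (hp1 i)),
      mul_le_mul_of_nonneg_right h2 (hp0 i)]
  calc ∑ i, min (s i) c ^ 2 ≤ ∑ i, ((s i ^ 2 - s i ^ 2 * p i) + M ^ 2 * p i) :=
        Finset.sum_le_sum fun i _ => hterm i
    _ = (frobInner X X - frobInner (X * V) (X * V)) + M ^ 2 * ∑ i, p i := by
        rw [hXX, hXV, Finset.sum_add_distrib, Finset.sum_sub_distrib, Finset.mul_sum]
    _ ≤ r * M ^ 2 + frobInner G G := by
        rw [hdiff]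
        nlinarith [mul_le_mul_of_nonneg_left hpr (sq_nonneg M), frobInner_self_nonneg (G * V)]

/-! ### Expectations under bounded anisotropy -/

theorem integrable_frobInner_and_integral_eq {Ω : Type*} [MeasurableSpace Ω] {P : Measure Ω}
    {m n : ℕ} (H : Matrix (Fin m) (Fin n) ℝ) {A : Ω → Matrix (Fin m) (Fin n) ℝ}
    (hA : ∀ i j, Integrable (fun ω => A ω i j) P) :
    Integrable (fun ω => frobInner H (A ω)) P ∧
      ∫ ω, frobInner H (A ω) ∂P = frobInner H (matrixExpectation P A) := by
  simp only [frobInner_eq_sum, matrixExpectation, Matrix.of_apply]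
  have h1 : ∀ i j, Integrable (fun ω => H i j * A ω i j) P := fun i j => (hA i j).const_mul _
  have h2 : ∀ i, Integrable (fun ω => ∑ j, H i j * A ω i j) P := fun i =>
    integrable_finsetSum _ fun j _ => h1 i j
  refine ⟨integrable_finsetSum _ fun i _ => h2 i, ?_⟩
  rw [integral_finsetSum _ fun i _ => h2 i]
  refine Finset.sum_congr rfl fun i _ => ?_
  rw [integral_finsetSum _ fun j _ => h1 i j]
  exact Finset.sum_congr rfl fun j _ => integral_const_mul _ _

theorem measurable_matrix_apply {m n : ℕ} (i : Fin m) (j : Fin n) :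
    Measurable fun A : Matrix (Fin m) (Fin n) ℝ => A i j :=
  (measurable_pi_apply j).comp (measurable_pi_apply i)

theorem abs_apply_le_one_of_orthonormal {d r : ℕ} {U : Matrix (Fin d) (Fin r) ℝ}
    (hU : U.transpose * U = 1) (i : Fin d) (k : Fin r) : |U i k| ≤ 1 := by
  have h := congrFun (congrFun hU k) k
  rw [Matrix.mul_apply, Matrix.one_apply_eq] at h
  have h1 := Finset.single_le_sum (f := fun a => U.transpose k a * U a k)
    (fun a _ => mul_self_nonneg (U a k)) (Finset.mem_univ i)
  rw [h] at h1
  exact abs_le_one_iff_mul_self_le_one.2 h1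

namespace HasBoundedAnisotropy

variable {Ω : Type*} [MeasurableSpace Ω] {P : Measure Ω} {d r : ℕ}
  {U : Ω → Matrix (Fin d) (Fin r) ℝ} {κ : ℝ}

theorem measurable_apply (hU : HasBoundedAnisotropy P U κ) (i : Fin d) (k : Fin r) :
    Measurable fun ω => U ω i k :=
  (measurable_matrix_apply i k).comp hU.measurable

theorem integrable_apply [IsFiniteMeasure P] (hU : HasBoundedAnisotropy P U κ) (i : Fin d)
    (k : Fin r) : Integrable (fun ω => U ω i k) P :=
  Integrable.of_bound (hU.measurable_apply i k).aestronglyMeasurable 1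
    (hU.orthonormal.mono fun _ h => abs_apply_le_one_of_orthonormal h i k)

theorem integral_apply (hU : HasBoundedAnisotropy P U κ) (i : Fin d) (k : Fin r) :
    ∫ ω, U ω i k ∂P = 0 :=
  congrFun (congrFun hU.mean_zero i) k

theorem integrable_mul_transpose_apply [IsFiniteMeasure P] (hU : HasBoundedAnisotropy P U κ)
    (i j : Fin d) : Integrable (fun ω => (U ω * (U ω).transpose) i j) P := by
  simp only [Matrix.mul_apply, Matrix.transpose_apply]
  refine integrable_finsetSum _ fun k _ => ?_
  refine Integrable.of_bound
    ((hU.measurable_apply i k).mul (hU.measurable_apply j k)).aestronglyMeasurable 1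
    (hU.orthonormal.mono fun _ h => ?_)
  rw [Real.norm_eq_abs, abs_mul]
  exact mul_le_one₀ (abs_apply_le_one_of_orthonormal h i k) (abs_nonneg _)
    (abs_apply_le_one_of_orthonormal h j k)

/-- The expected energy of a fixed matrix in the random range of `U`. -/
theorem integrable_and_integral_transpose_mul_le [IsFiniteMeasure P]
    (hU : HasBoundedAnisotropy P U κ) {n : ℕ} (G : Matrix (Fin d) (Fin n) ℝ) :
    Integrable (fun ω => frobInner ((U ω).transpose * G) ((U ω).transpose * G)) P ∧
      ∫ ω, frobInner ((U ω).transpose * G) ((U ω).transpose * G) ∂P ≤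
        κ * r / d * frobInner G G := by
  -- The energy is linear in UUᵀ, so its expectation depends only on 𝔼[UUᵀ].
  have h1 : ∀ ω, frobInner ((U ω).transpose * G) ((U ω).transpose * G) =
      frobInner (G * G.transpose) (U ω * (U ω).transpose) := by
    intro ω
    rw [frobInner_mul_transpose_left, frobInner_comm, frobInner_mul_left, Matrix.mul_assoc,
      Matrix.transpose_transpose]
  obtain ⟨h2, h3⟩ := integrable_frobInner_and_integral_eq (P := P) (G * G.transpose)
    (A := fun ω => U ω * (U ω).transpose) hU.integrable_mul_transpose_apply
  simp only [h1]
  refine ⟨h2, ?_⟩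
  rw [h3]
  -- The Loewner bound is conjugated by `G` and traced.
  have h4 := (hU.anisotropy.conjTranspose_mul_mul_same G).trace_nonneg
  rw [Matrix.conjTranspose_eq_transpose_of_trivial, Matrix.mul_sub, Matrix.sub_mul,
    Matrix.trace_sub, Matrix.mul_smul, Matrix.mul_one, Matrix.smul_mul, Matrix.trace_smul,
    smul_eq_mul] at h4
  have h5 : frobInner (G * G.transpose) (matrixExpectation P fun ω => U ω * (U ω).transpose) =
      (G.transpose * (matrixExpectation P fun ω => U ω * (U ω).transpose) * G).trace := by
    rw [frobInner_mul_transpose_left, frobInner, Matrix.mul_assoc]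
  rw [h5]
  exact sub_nonneg.1 h4

theorem integrable_and_integral_mul_le [IsFiniteMeasure P]
    (hU : HasBoundedAnisotropy P U κ) {m : ℕ} (G : Matrix (Fin m) (Fin d) ℝ) :
    Integrable (fun ω => frobInner (G * U ω) (G * U ω)) P ∧
      ∫ ω, frobInner (G * U ω) (G * U ω) ∂P ≤ κ * r / d * frobInner G G := by
  have h := hU.integrable_and_integral_transpose_mul_le G.transpose
  simpa only [← Matrix.transpose_mul, frobInner_transpose] using h

/-- A product of independent centred factors is centred. -/
theorem integrable_and_integral_frobInner_mul_transpose {n : ℕ}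
    {V : Ω → Matrix (Fin n) (Fin r) ℝ} {κ' : ℝ} [IsProbabilityMeasure P]
    (hU : HasBoundedAnisotropy P U κ) (hV : HasBoundedAnisotropy P V κ')
    (hUV : IndepFun U V P) (G : Matrix (Fin d) (Fin n) ℝ) :
    Integrable (fun ω => frobInner G (U ω * (V ω).transpose)) P ∧
      ∫ ω, frobInner G (U ω * (V ω).transpose) ∂P = 0 := by
  have hind : ∀ i j k, IndepFun (fun ω => U ω i k) (fun ω => V ω j k) P := fun i j k =>
    hUV.comp (measurable_matrix_apply i k) (measurable_matrix_apply j k)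
  have hint : ∀ i j k, Integrable (fun ω => U ω i k * V ω j k) P := fun i j k =>
    (hind i j k).integrable_mul (hU.integrable_apply i k) (hV.integrable_apply j k)
  obtain ⟨h1, h2⟩ := integrable_frobInner_and_integral_eq (P := P) G
    (A := fun ω => U ω * (V ω).transpose) fun i j => by
      simp only [Matrix.mul_apply, Matrix.transpose_apply]
      exact integrable_finsetSum _ fun k _ => hint i j k
  refine ⟨h1, ?_⟩
  have h3 : matrixExpectation P (fun ω => U ω * (V ω).transpose) = 0 := by
    ext i j
    simp only [matrixExpectation, Matrix.of_apply, Matrix.mul_apply, Matrix.transpose_apply,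
      Matrix.zero_apply]
    rw [integral_finsetSum _ fun k _ => hint i j k]
    refine Finset.sum_eq_zero fun k _ => ?_
    rw [(hind i j k).integral_fun_mul_eq_mul_integral (hU.measurable_apply i k).aestronglyMeasurable
      (hV.measurable_apply j k).aestronglyMeasurable, hU.integral_apply, zero_mul]
  rw [h2, h3]
  simp [frobInner]

end HasBoundedAnisotropy

/-! ### Proof of the main theorem -/

/-- Since r ≤ r², the hypothesis gives 25κr ≤ 25κr² ≤ q ≤ d; this also forces d > 0. -/
theorem anisotropy_factor_le {r d q : ℕ} {κ : ℝ} (hr : 1 ≤ r) (hκ0 : 0 < κ)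
    (hκ : κ ≤ (q : ℝ) / (25 * (r : ℝ) ^ 2)) (hqd : q ≤ d) : κ * r / d ≤ 1 / 25 := by
  have hr' : (1 : ℝ) ≤ r := by exact_mod_cast hr
  have hq : (q : ℝ) ≤ d := by exact_mod_cast hqd
  rw [le_div_iff₀ (by positivity)] at hκ
  have h1 : κ * r * 25 ≤ d := by
    nlinarith [mul_nonneg (mul_pos hκ0 (by linarith : (0 : ℝ) < r)).le (sub_nonneg.2 hr')]
  have hd : (0 : ℝ) < d := lt_of_lt_of_le (by positivity) h1
  rw [div_le_div_iff₀ hd (by norm_num)]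
  linarith

theorem lemma1 {Ω : Type*} [MeasurableSpace Ω] (P : Measure Ω) [IsProbabilityMeasure P]
    {m n r : ℕ} (hr : 1 ≤ r) (G : Matrix (Fin m) (Fin n) ℝ)
    (U : Ω → Matrix (Fin m) (Fin r) ℝ) (V : Ω → Matrix (Fin n) (Fin r) ℝ) (κ ℓ : ℝ)
    (hU : HasBoundedAnisotropy P U κ) (hV : HasBoundedAnisotropy P V κ)
    (hUV : IndepFun U V P)
    (hκ : κ ≤ ((min m n : ℕ) : ℝ) / (25 * (r : ℝ) ^ 2))
    (hℓ_pos : 0 < ℓ) (hℓ : 9 * Real.sqrt r * specNorm G ≤ ℓ)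
    (c : ℝ) (hc : specNorm G ≤ c)
    (g : Ω → Matrix (Fin m) (Fin n) ℝ) (hg : ∀ ω, g ω = G + ℓ • (U ω * (V ω).transpose)) :
    (Integrable (fun ω => frobInner G (spectralClip c (g ω))) P ∧
      frobNorm G ^ 2 / 3 ≤ ∫ ω, frobInner G (spectralClip c (g ω)) ∂P) ∧
    (Integrable (fun ω => frobNorm (spectralClip c (g ω)) ^ 2) P ∧
      ∫ ω, frobNorm (spectralClip c (g ω)) ^ 2 ∂P ≤
        r * min c (ℓ + specNorm G) ^ 2 + frobNorm G ^ 2) := by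
  have hc0 : 0 ≤ c := (specNorm_nonneg G).trans hc
  have hgm : Measurable g := by
    refine measurable_pi_iff.2 fun i => measurable_pi_iff.2 fun j => ?_
    simp only [hg, Matrix.add_apply, Matrix.smul_apply, Matrix.mul_apply, Matrix.transpose_apply,
      smul_eq_mul]
    exact measurable_const.add ((Finset.measurable_fun_sum _ fun k _ =>
      (hU.measurable_apply i k).mul (hV.measurable_apply j k)).const_mul _)
  have hclip : ∀ i j, Measurable fun ω => spectralClip c (g ω) i j := fun i j =>
    (measurable_spectralClip_apply hc0 i j).comp hgm
  have hint2 : Integrable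
      (fun ω => frobInner (spectralClip c (g ω)) (spectralClip c (g ω))) P := by
    refine Integrable.of_bound ?_ ((min m n : ℕ) * c ^ 2) (ae_of_all _ fun ω => ?_)
    · simp only [frobInner_eq_sum]
      exact (Finset.measurable_fun_sum _ fun i _ => Finset.measurable_fun_sum _ fun j _ =>
        (hclip i j).mul (hclip i j)).aestronglyMeasurable
    · rw [Real.norm_of_nonneg (frobInner_self_nonneg _)]
      exact frobInner_spectralClip_self_le hc0 _
  have hint1 : Integrable (fun ω => frobInner G (spectralClip c (g ω))) P := by
    -- Young's inequality dominates the alignment by the clipped energy, already known to be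
    -- integrable.
    refine ((integrable_const (frobInner G G / 4)).add hint2).mono' ?_
      (ae_of_all _ fun ω => abs_frobInner_le _ _)
    simp only [frobInner_eq_sum]
    exact (Finset.measurable_fun_sum _ fun i _ => Finset.measurable_fun_sum _ fun j _ =>
      (hclip i j).const_mul _).aestronglyMeasurable
  simp only [frobNorm_sq]
  refine ⟨⟨hint1, ?_⟩, hint2, ?_⟩
  · obtain ⟨iU, bU⟩ := hU.integrable_and_integral_transpose_mul_le G
    obtain ⟨iV, bV⟩ := hV.integrable_and_integral_mul_le G
    obtain ⟨iUV, bUV⟩ := hU.integrable_and_integral_frobInner_mul_transpose hV hUV G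
    have hG0 := frobInner_self_nonneg G
    have fU := mul_le_mul_of_nonneg_right
      (anisotropy_factor_le hr hU.pos hκ (min_le_left m n)) hG0
    have fV := mul_le_mul_of_nonneg_right
      (anisotropy_factor_le hr hU.pos hκ (min_le_right m n)) hG0
    have iR : Integrable (fun ω => frobInner G G / 2 -
        2 * (frobInner ((U ω).transpose * G) ((U ω).transpose * G) +
          frobInner (G * V ω) (G * V ω))) P :=
      (integrable_const _).sub ((iU.add iV).const_mul 2)
    have hmono : ∫ ω, (frobInner G G / 2 -
        2 * (frobInner ((U ω).transpose * G) ((U ω).transpose * G) +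
          frobInner (G * V ω) (G * V ω)) + min ℓ c * frobInner G (U ω * (V ω).transpose)) ∂P ≤
        ∫ ω, frobInner G (spectralClip c (g ω)) ∂P := by
      refine integral_mono_ae (iR.add (iUV.const_mul _)) hint1 ?_
      filter_upwards [hU.orthonormal, hV.orthonormal] with ω h1 h2
      rw [hg ω]
      exact le_frobInner_spectralClip hc0 hℓ_pos.le h1 h2 ((inSpecBall_specNorm G).mono hc)
    rw [integral_add iR (iUV.const_mul _),
      integral_sub (integrable_const _) (by exact (iU.add iV).const_mul 2), integral_const_mul,
      integral_const_mul, integral_add iU iV, bUV] at hmono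
    simp only [integral_const, probReal_univ, one_smul, mul_zero, add_zero] at hmono
    -- The constant is 1/2 − 2(1/25 + 1/25) = 17/50 ≥ 1/3.
    linarith
  · calc ∫ ω, frobInner (spectralClip c (g ω)) (spectralClip c (g ω)) ∂P
        ≤ ∫ _ω, (r * min c (ℓ + specNorm G) ^ 2 + frobInner G G) ∂P := by
          refine integral_mono_ae hint2 (integrable_const _) ?_
          filter_upwards [hU.orthonormal, hV.orthonormal] with ω h1 h2
          rw [hg ω]
          exact frobInner_spectralClip_perturbation_le hc0 hℓ_pos.le h1 h2 (inSpecBall_specNorm G)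
            rfl
      _ = _ := by simp
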